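/- Let $\frac12\le a<1$, $\alpha\ge 1$, $K>0$, and let $L:(0,\infty)\to(0,\infty)$ be measurable, bounded above on $(0,\infty)$, and bounded below near infinity (there are $c_0,t_0>0$ with $L(t)\ge c_0$ for all $t\ge t_0$), such that $\pi(t)=K\,t^{-a-1}L(t)$ is a probability density on $(0,\infty)$. For $\tau\ge 0$ let $\Pi_{n,\tau}$ be the prior on $\mathbb R^n$ under which the pairs $(\lambda_i^2,\theta_i)$, $1\le i\le n$, are independent, $\lambda_i^2$ has density $\pi$, and $\theta_i\mid\lambda_i^2\sim N(0,\lambda_i^2\tau^2)$. For $x\in\mathbb R^n$ let $\Pi_{n,\tau}(\cdot\mid X=x)$ be the posterior distribution of $\theta$ in the model $X\mid\theta\sim N_n(\theta,I_n)$, given by Bayes' formula. Let $(p_n)$ be a sequence of natural numbers with $p_n\to\infty$ and $p_n/n\to 0$ as $n\to\infty$, put $\tau_n=(p_n/n)^{\alpha}$, and let $l_0[p_n]$ be the set of $\theta\in\mathbb R^n$ with at most $p_n$ nonzero coordinates. Then for every real sequence $M_n\to\infty$, $$\sup_{\theta_0\in l_0[p_n]}E_{\theta_0}\,\Pi_{n,\tau_n}\Big(\theta:\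 \|\theta-\theta_0\|^2>M_n\,p_n\log\frac{n}{p_n}\,\Big|\,X\Big)\longrightarrow 0\qquad(n\to\infty),$$ where $E_{\theta_0}$ is expectation under $X\sim N_n(\theta_0,I_n)$ and $\|\cdot\|$ is the Euclidean norm. -/

import Mathlib

open MeasureTheory ProbabilityTheory Filter Topology

noncomputable section

namespace GlobalLocal

/-- The law on `(0, ∞)` of one squared local scale `λ²`, with Lebesgue density
`π(t) = K t ^ (-a - 1) L(t)`. -/
def localScaleLaw (K a : ℝ) (L : ℝ → ℝ) : Measure ℝ :=
  (volume.restrict (Set.Ioi (0 : ℝ))).withDensity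
    (fun t => ENNReal.ofReal (K * t ^ (-a - 1) * L t))

/-- The law of one coordinate `θᵢ` under the hierarchy
`θᵢ | λᵢ² ~ N(0, λᵢ² τ²)`, `λᵢ² ~ π`. -/
def coordPrior (K a : ℝ) (L : ℝ → ℝ) (τ : ℝ) : Measure ℝ :=
  (localScaleLaw K a L).bind (fun t => gaussianReal 0 (t * τ ^ 2).toNNReal)

/-- The prior on `θ ∈ ℝⁿ`: the pairs `(λᵢ², θᵢ)` are independent over `i`, hence so are the
coordinates `θᵢ`. -/
def prior (K a : ℝ) (L : ℝ → ℝ) (τ : ℝ) (n : ℕ) : Measure (Fin n → ℝ) :=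
  Measure.pi (fun _ => coordPrior K a L τ)

/-- The normal distribution `N_n(θ, I_n)` of the observation `X`. -/
def modelLaw {n : ℕ} (θ : Fin n → ℝ) : Measure (Fin n → ℝ) :=
  Measure.pi (fun i => gaussianReal (θ i) 1)

/-- The Lebesgue density of `N_n(θ, I_n)` at `x`. -/
def likelihood {n : ℕ} (θ x : Fin n → ℝ) : ENNReal :=
  ∏ i, gaussianPDF (θ i) 1 (x i)

/-- The posterior distribution of `θ` given `X = x` for the prior law `P`, by Bayes' formula
`dΠ(θ | x) = p(x | θ) dP(θ) / ∫ p(x | ϑ) dP(ϑ)`. -/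
def posteriorLaw {n : ℕ} (P : Measure (Fin n → ℝ)) (x : Fin n → ℝ) : Measure (Fin n → ℝ) :=
  (∫⁻ θ, likelihood θ x ∂P)⁻¹ • P.withDensity (fun θ => likelihood θ x)

/-- The nearly black vectors `l₀[p]`: at most `p` nonzero coordinates. -/
def nearlyBlack (n p : ℕ) : Set (Fin n → ℝ) :=
  {θ | {j : Fin n | θ j ≠ 0}.ncard ≤ p}

/-- Squared Euclidean distance between two vectors. -/
def sqDist {n : ℕ} (θ η : Fin n → ℝ) : ℝ :=
  ‖WithLp.toLp 2 (θ - η)‖ ^ 2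

end GlobalLocal

end

/-!
The argument bounds the posterior mean of the squared loss and applies Markov's inequality.

For a product prior the posterior is again a product, so the expected posterior mass of
`‖θ - θ₀‖² > R` is at most `R⁻¹` times the sum over `i` of the one-dimensional risks
`coordRisk ν (θ₀ i)`, the expectation under `X ~ N(θ₀ i, 1)` of the posterior mean of
`(θ - θ₀ i)²` (`lintegral_posteriorLaw_le`). Given the local scale `t`, write `u = t τ²`. Then
`X ~ N(0, 1 + u)` and `θ | X = x` is normal with mean `u x / (1 + u)` and variance `u / (1 + u)`, so
the risks become integrals over `t` against `K t ^ (-a - 1) L t`.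

At mean zero the posterior loss is at most `(1 + x²) E[u / (1 + u) | x]`. Its numerator is `O(τ)`
uniformly in `x` (`exists_unnormSqLoss_zero_le`; this uses `1/2 ≤ a < 1` and the upper bound on
`L`), while the marginal density of `X` is at least a multiple of `exp (-x² / 2)`. Integrating the
resulting bound `C τ exp (x² / 2)` over moderate `x`, and the trivial bound `1 + x²` in the tail,
gives a risk `O(τ (1 + log (1 / τ)))` (`exists_coordRisk_zero_le`).

At an arbitrary mean `c` the loss is at most `1 + 2 (x - c)² + 2 x² E[(1 + u)⁻² | x]`. Scales with
`x² / (1 + u) ≤ 8 log (1 / τ)` contribute `O(log (1 / τ))`. The others carry unnormalized mass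
`O(τ² / |x|³)`, and by the lower bound on `L` the prior tail makes the marginal density of `X` at
least of that order (`le_evidence_of_large`). So the risk is `O(1 + log (1 / τ))` uniformly in `c`
(`exists_coordRisk_le`).

With `τ = (p / n) ^ α ≤ p / n` the `n` coordinates and the at most `p` nonzero ones each add up to
`O(p log (n / p))`, and dividing by `M p log (n / p)` leaves `O(1 / M)`.
-/

noncomputable section

namespace GlobalLocal

/-! ### Reduction of the posterior mass to coordinate risks -/

/-- The marginal density at `x` of one observation `X ~ N(θ, 1)` when `θ ~ ν`. -/
def evidence (ν : Measure ℝ) (x : ℝ) : ENNReal :=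
  ∫⁻ θ, gaussianPDF θ 1 x ∂ν

/-- The unnormalized posterior mean of `(θ - c)²` given one observation `x`, for the prior `ν`. -/
def unnormSqLoss (ν : Measure ℝ) (c x : ℝ) : ENNReal :=
  ∫⁻ θ, ENNReal.ofReal ((θ - c) ^ 2) * gaussianPDF θ 1 x ∂ν

/-- The expectation, under `X ~ N(c, 1)`, of the posterior mean of `(θ - c)²` for the prior `ν`. -/
def coordRisk (ν : Measure ℝ) (c : ℝ) : ENNReal :=
  ∫⁻ x, unnormSqLoss ν c x / evidence ν x ∂(gaussianReal c 1)

lemma measurable_gaussianPDF_one : Measurable fun q : ℝ × ℝ => gaussianPDF q.1 1 q.2 := by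
  unfold gaussianPDF gaussianPDFReal
  fun_prop

lemma measurable_gaussianPDF_mean (x : ℝ) : Measurable fun θ : ℝ => gaussianPDF θ 1 x := by
  unfold gaussianPDF gaussianPDFReal
  fun_prop

lemma measurable_evidence (ν : Measure ℝ) [SFinite ν] : Measurable (evidence ν) :=
  (measurable_gaussianPDF_one.comp measurable_swap).lintegral_prod_right'

lemma measurable_unnormSqLoss (ν : Measure ℝ) [SFinite ν] (c : ℝ) :
    Measurable (unnormSqLoss ν c) :=
  Measurable.lintegral_prod_right'
    (f := fun q : ℝ × ℝ => ENNReal.ofReal ((q.2 - c) ^ 2) * gaussianPDF q.2 1 q.1)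
    (Measurable.mul (by fun_prop) (measurable_gaussianPDF_one.comp measurable_swap))

lemma evidence_ne_zero (ν : Measure ℝ) [IsProbabilityMeasure ν] (x : ℝ) : evidence ν x ≠ 0 := by
  intro h
  rw [evidence, lintegral_eq_zero_iff (measurable_gaussianPDF_mean x)] at h
  obtain ⟨θ, hθ⟩ := h.exists
  exact (gaussianPDF_pos θ one_ne_zero x).ne' hθ

lemma gaussianPDF_one_le_one (θ x : ℝ) : gaussianPDF θ 1 x ≤ 1 := by
  rw [gaussianPDF, ENNReal.ofReal_le_one, gaussianPDFReal]
  have h1 : 1 ≤ √(2 * Real.pi * ((1 : NNReal) : ℝ)) := by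
    rw [Real.one_le_sqrt]
    have := Real.pi_gt_three
    norm_num
    linarith
  have h2 : Real.exp (-(x - θ) ^ 2 / (2 * ((1 : NNReal) : ℝ))) ≤ 1 := by
    rw [Real.exp_le_one_iff, neg_div, neg_nonpos]
    positivity
  exact mul_le_one₀ (inv_le_one_of_one_le₀ h1) (Real.exp_nonneg _) h2

lemma evidence_ne_top (ν : Measure ℝ) [IsProbabilityMeasure ν] (x : ℝ) : evidence ν x ≠ ⊤ := by
  refine ((lintegral_mono fun θ => gaussianPDF_one_le_one θ x).trans_lt ?_).ne
  simp

lemma lintegral_pi_prod {n : ℕ} (ν : Measure ℝ) [IsProbabilityMeasure ν]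
    (f : Fin n → ℝ → ENNReal) (hf : ∀ i, Measurable (f i)) :
    ∫⁻ θ, ∏ i, f i (θ i) ∂(Measure.pi fun _ : Fin n => ν) = ∏ i, ∫⁻ t, f i t ∂ν := by
  rw [lintegral_prod_eq_prod_lintegral_of_indepFun Finset.univ
    (fun i (θ : Fin n → ℝ) => f i (θ i)) (iIndepFun_pi fun i => (hf i).aemeasurable)
    (fun i => (hf i).comp (measurable_pi_apply i))]
  refine Finset.prod_congr rfl fun i _ => ?_
  exact (measurePreserving_eval (fun _ : Fin n => ν) i).lintegral_comp (hf i)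

lemma measurable_likelihood {n : ℕ} (x : Fin n → ℝ) :
    Measurable fun θ : Fin n → ℝ => likelihood θ x :=
  Finset.measurable_fun_prod _ fun i _ =>
    (measurable_gaussianPDF_mean (x i)).comp (measurable_pi_apply i)

lemma lintegral_likelihood {n : ℕ} (ν : Measure ℝ) [IsProbabilityMeasure ν] (x : Fin n → ℝ) :
    ∫⁻ θ, likelihood θ x ∂(Measure.pi fun _ => ν) = ∏ i, evidence ν (x i) :=
  lintegral_pi_prod ν _ fun i => measurable_gaussianPDF_mean (x i)

lemma lintegral_likelihood_mul_sq {n : ℕ} (ν : Measure ℝ) [IsProbabilityMeasure ν]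
    (x : Fin n → ℝ) (i : Fin n) (c : ℝ) :
    ∫⁻ θ, likelihood θ x * ENNReal.ofReal ((θ i - c) ^ 2) ∂(Measure.pi fun _ => ν) =
      unnormSqLoss ν c (x i) * ∏ j ∈ Finset.univ.erase i, evidence ν (x j) := by
  have key := lintegral_pi_prod ν
    (fun j t => (if j = i then ENNReal.ofReal ((t - c) ^ 2) else 1) * gaussianPDF t 1 (x j))
    (fun j => Measurable.mul (by split_ifs <;> fun_prop) (measurable_gaussianPDF_mean (x j)))
  rw [← Finset.mul_prod_erase Finset.univ _ (Finset.mem_univ i)] at key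
  have h1 : ∀ θ : Fin n → ℝ, likelihood θ x * ENNReal.ofReal ((θ i - c) ^ 2) =
      ∏ j, (if j = i then ENNReal.ofReal ((θ j - c) ^ 2) else 1) * gaussianPDF (θ j) 1 (x j) := by
    intro θ
    rw [Finset.prod_mul_distrib, Finset.prod_ite_eq' Finset.univ i]
    simp [likelihood, mul_comm]
  simp_rw [h1]
  rw [key]
  congr 1
  · simp [unnormSqLoss]
  · refine Finset.prod_congr rfl fun j hj => ?_
    simp [evidence, Finset.ne_of_mem_erase hj]

lemma sqDist_eq_sum {n : ℕ} (θ η : Fin n → ℝ) : sqDist θ η = ∑ i, (θ i - η i) ^ 2 := by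
  simp [sqDist, EuclideanSpace.norm_sq_eq]

/-- The posterior for a product prior is a product, so the posterior mean of the squared distance
splits into coordinates. -/
lemma lintegral_sqDist_posteriorLaw {n : ℕ} (ν : Measure ℝ) [IsProbabilityMeasure ν]
    (x θ₀ : Fin n → ℝ) :
    ∫⁻ θ, ENNReal.ofReal (sqDist θ θ₀) ∂(posteriorLaw (Measure.pi fun _ => ν) x) =
      ∑ i, unnormSqLoss ν (θ₀ i) (x i) / evidence ν (x i) := by
  have hmeas : ∀ i : Fin n, Measurable fun θ : Fin n → ℝ => ENNReal.ofReal ((θ i - θ₀ i) ^ 2) :=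
    fun i => by fun_prop
  have hsum : ∀ θ : Fin n → ℝ, ENNReal.ofReal (sqDist θ θ₀) =
      ∑ i, ENNReal.ofReal ((θ i - θ₀ i) ^ 2) := fun θ => by
    rw [sqDist_eq_sum, ENNReal.ofReal_sum_of_nonneg fun i _ => sq_nonneg _]
  simp_rw [hsum]
  rw [posteriorLaw, lintegral_smul_measure, smul_eq_mul,
    lintegral_finsetSum _ fun i _ => hmeas i, Finset.mul_sum]
  refine Finset.sum_congr rfl fun i _ => ?_
  rw [lintegral_withDensity_eq_lintegral_mul _ (measurable_likelihood x) (hmeas i)]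
  simp only [Pi.mul_apply]
  rw [lintegral_likelihood_mul_sq, lintegral_likelihood,
    ← Finset.mul_prod_erase Finset.univ _ (Finset.mem_univ i)]
  set E := ∏ j ∈ Finset.univ.erase i, evidence ν (x j)
  have hE0 : E ≠ 0 := Finset.prod_ne_zero_iff.2 fun j _ => evidence_ne_zero ν (x j)
  have hEt : E ≠ ⊤ := ENNReal.prod_ne_top fun j _ => evidence_ne_top ν (x j)
  rw [mul_comm, ← div_eq_mul_inv, ENNReal.mul_div_mul_right _ _ hE0 hEt]

/-- Markov's inequality, integrated over the data, bounds the expected posterior mass outside a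
ball by the sum of the coordinate risks. -/
lemma lintegral_posteriorLaw_le {n : ℕ} (ν : Measure ℝ) [IsProbabilityMeasure ν]
    (θ₀ : Fin n → ℝ) {R : ℝ} (hR : 0 < R) :
    ∫⁻ x, posteriorLaw (Measure.pi fun _ => ν) x {θ | R < sqDist θ θ₀} ∂(modelLaw θ₀) ≤
      (∑ i, coordRisk ν (θ₀ i)) / ENNReal.ofReal R := by
  have hm : ∀ i, Measurable fun t => unnormSqLoss ν (θ₀ i) t / evidence ν t := fun i =>
    (measurable_unnormSqLoss ν _).div (measurable_evidence ν)
  have hmx : ∀ i, Measurable fun x : Fin n → ℝ =>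
      unnormSqLoss ν (θ₀ i) (x i) / evidence ν (x i) := fun i =>
    (hm i).comp (measurable_pi_apply i)
  have hd : Measurable fun θ : Fin n → ℝ => ENNReal.ofReal (sqDist θ θ₀) := by
    simp_rw [sqDist_eq_sum]
    fun_prop
  have markov : ∀ x : Fin n → ℝ,
      posteriorLaw (Measure.pi fun _ => ν) x {θ | R < sqDist θ θ₀} ≤
        (∑ i, unnormSqLoss ν (θ₀ i) (x i) / evidence ν (x i)) / ENNReal.ofReal R := by
    intro x
    rw [← lintegral_sqDist_posteriorLaw ν x θ₀]
    refine (measure_mono fun θ hθ => ?_).trans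
      (meas_ge_le_lintegral_div hd.aemeasurable (ENNReal.ofReal_pos.2 hR).ne' ENNReal.ofReal_ne_top)
    exact ENNReal.ofReal_le_ofReal (le_of_lt hθ)
  refine (lintegral_mono markov).trans_eq ?_
  simp_rw [div_eq_mul_inv _ (ENNReal.ofReal R)]
  rw [lintegral_mul_const _ (Finset.measurable_fun_sum _ fun i _ => hmx i),
    lintegral_finsetSum _ fun i _ => hmx i]
  congr 1
  refine Finset.sum_congr rfl fun i _ => ?_
  exact (measurePreserving_eval (fun i => gaussianReal (θ₀ i) 1) i).lintegral_comp (hm i)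

/-! ### Normal conjugacy and the scale-mixture prior -/

/-- The density at `x` of the normal distribution with mean `0` and variance `1 + u`: the marginal
density of `X ~ N(θ, 1)` under `θ ~ N(0, u)`. -/
def marginalDensity (u x : ℝ) : ℝ :=
  (√(2 * Real.pi * (1 + u)))⁻¹ * Real.exp (-x ^ 2 / (2 * (1 + u)))

lemma marginalDensity_nonneg (u x : ℝ) : 0 ≤ marginalDensity u x := by
  unfold marginalDensity
  positivity

@[fun_prop]
lemma measurable_marginalDensity (x : ℝ) : Measurable fun u => marginalDensity u x := by
  unfold marginalDensity
  fun_prop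

/-- Normal conjugacy: joint density of `(θ, X)` = marginal density of `X` times the posterior
density of `θ`, which is normal with mean `u x / (1 + u)` and variance `u / (1 + u)`. -/
lemma gaussianPDFReal_mul_gaussianPDFReal {v : NNReal} (hv : v ≠ 0) (θ x : ℝ) :
    gaussianPDFReal 0 v θ * gaussianPDFReal θ 1 x =
      marginalDensity v x * gaussianPDFReal ((v / (1 + v) : NNReal) * x) (v / (1 + v)) θ := by
  have hv' : (0 : ℝ) < v := by exact_mod_cast pos_iff_ne_zero.2 hv
  have hpi := Real.pi_pos
  simp only [gaussianPDFReal, marginalDensity, NNReal.coe_one, mul_one, NNReal.coe_div,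
    NNReal.coe_add, sub_zero]
  rw [mul_mul_mul_comm, mul_mul_mul_comm (√(2 * Real.pi * (1 + (v : ℝ))))⁻¹, ← Real.exp_add,
    ← Real.exp_add, ← mul_inv, ← mul_inv, ← Real.sqrt_mul (by positivity),
    ← Real.sqrt_mul (by positivity)]
  congr 1
  · congr 2
    field_simp
  · congr 1
    field_simp
    ring

lemma lintegral_mul_gaussianPDF {v : NNReal} (hv : v ≠ 0) (x : ℝ) {f : ℝ → ENNReal}
    (hf : Measurable f) :
    ∫⁻ θ, f θ * gaussianPDF θ 1 x ∂(gaussianReal 0 v) =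
      ENNReal.ofReal (marginalDensity v x) *
        ∫⁻ θ, f θ ∂(gaussianReal ((v / (1 + v) : NNReal) * x) (v / (1 + v))) := by
  have hf' : Measurable fun θ => f θ * gaussianPDF θ 1 x :=
    hf.mul (measurable_gaussianPDF_mean x)
  have hz : v / (1 + v) ≠ 0 := div_ne_zero hv (by positivity)
  rw [gaussianReal_of_var_ne_zero _ hv, gaussianReal_of_var_ne_zero _ hz,
    lintegral_withDensity_eq_lintegral_mul _ (measurable_gaussianPDF _ _) hf',
    lintegral_withDensity_eq_lintegral_mul _ (measurable_gaussianPDF _ _) hf,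
    ← lintegral_const_mul _ ((measurable_gaussianPDF _ _).mul hf)]
  refine lintegral_congr fun θ => ?_
  have h : gaussianPDF 0 v θ * gaussianPDF θ 1 x = ENNReal.ofReal (marginalDensity v x) *
      gaussianPDF ((v / (1 + v) : NNReal) * x) (v / (1 + v)) θ := by
    simp only [gaussianPDF]
    rw [← ENNReal.ofReal_mul (gaussianPDFReal_nonneg _ _ _),
      ← ENNReal.ofReal_mul (marginalDensity_nonneg _ _), gaussianPDFReal_mul_gaussianPDFReal hv]
  simp only [Pi.mul_apply]
  calc gaussianPDF 0 v θ * (f θ * gaussianPDF θ 1 x)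
      = f θ * (gaussianPDF 0 v θ * gaussianPDF θ 1 x) := by ring
    _ = _ := by rw [h]; ring

lemma lintegral_sq_sub_gaussianReal (m c : ℝ) (v : NNReal) :
    ∫⁻ θ, ENNReal.ofReal ((θ - c) ^ 2) ∂(gaussianReal m v) =
      ENNReal.ofReal ((m - c) ^ 2 + v) := by
  have hL : MemLp (fun θ : ℝ => θ - c) 2 (gaussianReal m v) :=
    (memLp_id_gaussianReal 2).sub (memLp_const c)
  have hi : Integrable (fun θ : ℝ => θ) (gaussianReal m v) :=
    (memLp_id_gaussianReal 1).integrable le_rfl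
  have hvar := variance_eq_sub hL
  rw [variance_sub_const (by fun_prop), variance_fun_id_gaussianReal,
    integral_sub hi (integrable_const c), integral_id_gaussianReal] at hvar
  simp only [integral_const, probReal_univ, smul_eq_mul, one_mul] at hvar
  rw [← ofReal_integral_eq_lintegral_ofReal hL.integrable_sq (ae_of_all _ fun _ => sq_nonneg _)]
  congr 1
  simp only [Pi.pow_apply] at hvar
  linarith

section CoordPrior

variable {K a : ℝ} {L : ℝ → ℝ}

lemma measurable_gaussianReal_scale (τ : ℝ) :
    Measurable fun t : ℝ => gaussianReal 0 (t * τ ^ 2).toNNReal :=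
  measurable_gaussianReal.comp
    (measurable_const.prodMk (by fun_prop : Measurable fun t : ℝ => (t * τ ^ 2).toNNReal))

lemma isProbabilityMeasure_coordPrior [IsProbabilityMeasure (localScaleLaw K a L)] (τ : ℝ) :
    IsProbabilityMeasure (coordPrior K a L τ) := by
  refine ⟨?_⟩
  rw [coordPrior, Measure.bind_apply MeasurableSet.univ
    (measurable_gaussianReal_scale τ).aemeasurable]
  simp

lemma ae_localScaleLaw_pos : ∀ᵐ t ∂(localScaleLaw K a L), 0 < t :=
  (withDensity_absolutelyContinuous _ _).ae_le (ae_restrict_mem measurableSet_Ioi)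

lemma lintegral_coordPrior (τ : ℝ) {f : ℝ → ENNReal} (hf : Measurable f) :
    ∫⁻ θ, f θ ∂(coordPrior K a L τ) =
      ∫⁻ t, ∫⁻ θ, f θ ∂(gaussianReal 0 (t * τ ^ 2).toNNReal) ∂(localScaleLaw K a L) :=
  Measure.lintegral_bind (measurable_gaussianReal_scale τ).aemeasurable hf.aemeasurable

lemma evidence_coordPrior {τ : ℝ} (hτ : 0 < τ) (x : ℝ) :
    evidence (coordPrior K a L τ) x =
      ∫⁻ t, ENNReal.ofReal (marginalDensity (t * τ ^ 2) x) ∂(localScaleLaw K a L) := by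
  rw [evidence, lintegral_coordPrior τ (measurable_gaussianPDF_mean x)]
  refine lintegral_congr_ae (ae_localScaleLaw_pos.mono fun t ht => ?_)
  have hu : 0 < t * τ ^ 2 := by positivity
  have h := lintegral_mul_gaussianPDF (v := (t * τ ^ 2).toNNReal) (by simpa using hu) x
    (f := fun _ => 1) measurable_const
  simpa [hu.le] using h

lemma unnormSqLoss_coordPrior {τ : ℝ} (hτ : 0 < τ) (c x : ℝ) :
    unnormSqLoss (coordPrior K a L τ) c x =
      ∫⁻ t, ENNReal.ofReal (marginalDensity (t * τ ^ 2) x *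
        ((t * τ ^ 2 / (1 + t * τ ^ 2) * x - c) ^ 2 + t * τ ^ 2 / (1 + t * τ ^ 2)))
        ∂(localScaleLaw K a L) := by
  have hm : Measurable fun θ : ℝ => ENNReal.ofReal ((θ - c) ^ 2) * gaussianPDF θ 1 x :=
    Measurable.mul (by fun_prop) (measurable_gaussianPDF_mean x)
  rw [unnormSqLoss, lintegral_coordPrior τ hm]
  refine lintegral_congr_ae (ae_localScaleLaw_pos.mono fun t ht => ?_)
  have hu : 0 < t * τ ^ 2 := by positivity
  simp only
  rw [lintegral_mul_gaussianPDF (by simpa using hu) x (by fun_prop),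
    lintegral_sq_sub_gaussianReal, ← ENNReal.ofReal_mul (marginalDensity_nonneg _ _)]
  simp [hu.le]

end CoordPrior

/-! ### Risk at an arbitrary mean -/

lemma lintegral_localScaleLaw {K a : ℝ} {L : ℝ → ℝ} (hL : Measurable L) {f : ℝ → ENNReal}
    (hf : Measurable f) :
    ∫⁻ t, f t ∂(localScaleLaw K a L) =
      ∫⁻ t in Set.Ioi 0, ENNReal.ofReal (K * t ^ (-a - 1) * L t) * f t := by
  rw [localScaleLaw, lintegral_withDensity_eq_lintegral_mul _ (by fun_prop) hf]
  rfl

lemma one_le_sqrt_two_pi_mul {u : ℝ} (hu : 0 ≤ u) : 1 ≤ √(2 * Real.pi * (1 + u)) := by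
  rw [Real.one_le_sqrt]
  nlinarith [Real.pi_gt_three]

lemma pow_mul_exp_neg_le {y : ℝ} (hy : 0 ≤ y) :
    (y ^ 2 + y ^ 3) * Real.exp (-(y / 4)) ≤ 416 := by
  have h2 := Real.pow_div_factorial_le_exp (y / 4) (by positivity) 2
  have h3 := Real.pow_div_factorial_le_exp (y / 4) (by positivity) 3
  rw [Real.exp_neg, ← div_eq_mul_inv, div_le_iff₀ (Real.exp_pos _)]
  norm_num [Nat.factorial] at h2 h3
  nlinarith

/-- Far from the origin the posterior shrinks little: at a scale `u` with `x² / (1 + u)` above the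
threshold `8 log (1 / τ)`, the normal factor is small enough to give the second term. -/
lemma sq_shrinkage_mul_marginalDensity_le {τ u x : ℝ} (hτ : 0 < τ) (hτ1 : τ ≤ 1) (hu : 0 ≤ u)
    (hx : x ≠ 0) :
    (x / (1 + u)) ^ 2 * marginalDensity u x ≤
      8 * Real.log (1 / τ) * marginalDensity u x + 416 * (τ ^ 2 / |x| ^ 3) := by
  have hl : 0 ≤ Real.log (1 / τ) := Real.log_nonneg (by rw [le_div_iff₀ hτ]; linarith)
  have hm := marginalDensity_nonneg u x
  have hx0 : 0 < |x| := abs_pos.2 hx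
  set y := x ^ 2 / (1 + u) with hy
  have hy0 : 0 ≤ y := by positivity
  have hxy : (x / (1 + u)) ^ 2 ≤ y := by
    rw [hy, div_pow]
    gcongr
    nlinarith
  rcases le_or_gt y (8 * Real.log (1 / τ)) with h | h
  · have := mul_le_mul_of_nonneg_right (hxy.trans h) hm
    have : 0 ≤ 416 * (τ ^ 2 / |x| ^ 3) := by positivity
    linarith
  · -- Half of the exponent `y / 2` pays for `τ²`; the other half absorbs the powers of `y`.
    have hmain : (x / (1 + u)) ^ 2 * marginalDensity u x ≤ 416 * (τ ^ 2 / |x| ^ 3) := by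
      have hw : 0 < √(1 + u) := Real.sqrt_pos.2 (by linarith)
      have hw2 : √(1 + u) ^ 2 = 1 + u := Real.sq_sqrt (by linarith)
      set w := √(1 + u)
      have hs : y = (|x| / w) ^ 2 := by rw [hy, div_pow, sq_abs, hw2]
      set s := |x| / w with hsdef
      have hs0 : 0 ≤ s := by positivity
      have hprefix : (√(2 * Real.pi * (1 + u)))⁻¹ ≤ w⁻¹ := by
        have : w ≤ √(2 * Real.pi * (1 + u)) :=
          Real.sqrt_le_sqrt (by nlinarith [Real.pi_gt_three])
        gcongr
      have hexp : Real.exp (-x ^ 2 / (2 * (1 + u))) ≤ Real.exp (-(y / 4)) * τ ^ 2 := by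
        have e1 : -x ^ 2 / (2 * (1 + u)) = -(y / 4) + -(y / 4) := by
          rw [hy]
          field_simp
          ring
        have e2 : Real.exp (-(y / 4)) ≤ τ ^ 2 := by
          have : τ ^ 2 = Real.exp (2 * Real.log τ) := by
            rw [two_mul, Real.exp_add, Real.exp_log hτ, sq]
          rw [this, Real.exp_le_exp]
          rw [one_div, Real.log_inv] at h
          linarith
        rw [e1, Real.exp_add]
        gcongr
      have hs5 : s ^ 5 * Real.exp (-(y / 4)) ≤ 416 := by
        refine le_trans ?_ (pow_mul_exp_neg_le hy0)
        gcongr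
        rw [hs]
        nlinarith [mul_nonneg (pow_nonneg hs0 4) (sq_nonneg (s - 1)), pow_nonneg hs0 4,
          pow_nonneg hs0 6]
      have hxs : (x / (1 + u)) ^ 2 * w⁻¹ = s ^ 5 / |x| ^ 3 := by
        rw [hsdef, ← sq_abs, abs_div, ← hw2, abs_of_pos (pow_pos hw 2)]
        field_simp
      calc (x / (1 + u)) ^ 2 * marginalDensity u x
          ≤ (x / (1 + u)) ^ 2 * (w⁻¹ * (Real.exp (-(y / 4)) * τ ^ 2)) := by
            unfold marginalDensity
            gcongr
        _ = ((x / (1 + u)) ^ 2 * w⁻¹) * (Real.exp (-(y / 4)) * τ ^ 2) := by ring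
        _ = (s ^ 5 * Real.exp (-(y / 4))) * (τ ^ 2 / |x| ^ 3) := by
            rw [hxs]
            ring
        _ ≤ 416 * (τ ^ 2 / |x| ^ 3) := by gcongr
    have : 0 ≤ 8 * Real.log (1 / τ) * marginalDensity u x := by positivity
    linarith

lemma le_marginalDensity {u x : ℝ} (hx : 1 ≤ |x|) (h1 : x ^ 2 ≤ u) (h2 : u ≤ 2 * x ^ 2) :
    Real.exp (-1) / (5 * |x|) ≤ marginalDensity u x := by
  have hx2 : 1 ≤ x ^ 2 := by rw [← sq_abs]; nlinarith
  have hpi := Real.pi_lt_d2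
  have h5 : √(2 * Real.pi * (1 + u)) ≤ 5 * |x| := by
    rw [Real.sqrt_le_left (by positivity), mul_pow, sq_abs]
    nlinarith [Real.pi_pos]
  have h0 := one_le_sqrt_two_pi_mul (by linarith : 0 ≤ u)
  have he : -1 ≤ -x ^ 2 / (2 * (1 + u)) := by
    rw [le_div_iff₀ (by linarith)]
    linarith
  rw [marginalDensity, div_eq_inv_mul]
  gcongr

section Prior

variable {K a : ℝ} {L : ℝ → ℝ}

/-- The heavy tail of the prior keeps the marginal density polynomially large: only scales
`t τ²` between `x²` and `2 x²` are needed. -/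
lemma le_evidence_of_large {c₀ t₀ τ x : ℝ} (hK : 0 < K) (ha' : a < 1) (hL : Measurable L)
    (hc₀ : 0 < c₀) (hLt : ∀ t, t₀ ≤ t → c₀ ≤ L t) (hτ : 0 < τ) (hτ1 : τ ≤ 1)
    (hx : 1 ≤ |x|) (hxt : t₀ ≤ x ^ 2) :
    ENNReal.ofReal (K * c₀ * Real.exp (-1) / 20 * (τ ^ 2 / |x| ^ 3)) ≤
      evidence (coordPrior K a L τ) x := by
  have hx0 : 0 < |x| := by linarith
  have hx2 : 1 ≤ x ^ 2 := by rw [← sq_abs]; nlinarith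
  have hτ2 : τ ^ 2 ≤ 1 := by nlinarith
  have hτ2' : 0 < τ ^ 2 := by positivity
  set b := x ^ 2 / τ ^ 2 with hb
  have hbx : x ^ 2 ≤ b := by
    rw [hb, le_div_iff₀ hτ2']
    nlinarith
  have hbτ : b * τ ^ 2 = x ^ 2 := by rw [hb]; field_simp
  rw [evidence_coordPrior hτ, lintegral_localScaleLaw hL (by fun_prop)]
  have hsub : Set.Icc b (2 * b) ⊆ Set.Ioi 0 := fun t ht => by
    have := ht.1
    simp only [Set.mem_Ioi]
    linarith
  refine le_trans ?_ (lintegral_mono_set hsub)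
  set δ := K * ((2 * b) ^ 2)⁻¹ * c₀ * (Real.exp (-1) / (5 * |x|)) with hδ
  have hpt : ∀ t ∈ Set.Icc b (2 * b), ENNReal.ofReal δ ≤
      ENNReal.ofReal (K * t ^ (-a - 1) * L t) *
        ENNReal.ofReal (marginalDensity (t * τ ^ 2) x) := by
    rintro t ⟨ht1, ht2⟩
    have ht : 1 ≤ t := by linarith
    have ht0 : 0 < t := by linarith
    have hLc := hLt t (by linarith)
    have hL0 : 0 < L t := by linarith
    rw [← ENNReal.ofReal_mul (by positivity)]
    refine ENNReal.ofReal_le_ofReal ?_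
    have hpow : ((2 * b) ^ 2)⁻¹ ≤ t ^ (-a - 1) := by
      calc ((2 * b) ^ 2)⁻¹ ≤ (t ^ 2)⁻¹ := by gcongr
        _ = t ^ (-2 : ℝ) := by rw [Real.rpow_neg ht0.le, Real.rpow_two]
        _ ≤ t ^ (-a - 1) := Real.rpow_le_rpow_of_exponent_le ht (by linarith)
    have hm := le_marginalDensity (u := t * τ ^ 2) hx (by nlinarith) (by nlinarith)
    rw [hδ]
    gcongr
  calc ENNReal.ofReal (K * c₀ * Real.exp (-1) / 20 * (τ ^ 2 / |x| ^ 3))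
      = ENNReal.ofReal δ * volume (Set.Icc b (2 * b)) := by
        rw [Real.volume_Icc, ← ENNReal.ofReal_mul (by positivity)]
        congr 1
        rw [hδ, hb, ← sq_abs x]
        field_simp
        ring
    _ = ∫⁻ _ in Set.Icc b (2 * b), ENNReal.ofReal δ := by rw [setLIntegral_const]
    _ ≤ _ := setLIntegral_mono' measurableSet_Icc hpt

/-- At every observation the posterior mean of `(θ - x)²` is at most of order `log (1 / τ)`, so the
posterior loss is controlled by `(x - c)²` up to that order. -/
lemma exists_unnormSqLoss_le (hK : 0 < K) (ha' : a < 1) (hL : Measurable L)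
    (hL_lower : ∃ c₀ t₀ : ℝ, 0 < c₀ ∧ 0 < t₀ ∧ ∀ t : ℝ, t₀ ≤ t → c₀ ≤ L t)
    [IsProbabilityMeasure (localScaleLaw K a L)] :
    ∃ C : ℝ, 0 ≤ C ∧ ∀ τ : ℝ, 0 < τ → τ ≤ 1 → ∀ c x : ℝ,
      unnormSqLoss (coordPrior K a L τ) c x ≤
        ENNReal.ofReal (1 + 2 * (x - c) ^ 2 + 2 * (C + 8 * Real.log (1 / τ))) *
          evidence (coordPrior K a L τ) x := by
  obtain ⟨c₀, t₀, hc₀, ht₀, hLt⟩ := hL_lower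
  set c₁ := K * c₀ * Real.exp (-1) / 20 with hc₁
  have hc₁0 : 0 < c₁ := by positivity
  set T := max 1 t₀ with hT
  have hT1 : 1 ≤ T := le_max_left _ _
  refine ⟨T + 416 / c₁, by positivity, fun τ hτ hτ1 c x => ?_⟩
  have hl : 0 ≤ Real.log (1 / τ) := Real.log_nonneg (by rw [le_div_iff₀ hτ]; linarith)
  set ν := coordPrior K a L τ
  have hsplit : ∀ u : ℝ, 0 < u →
      marginalDensity u x * ((u / (1 + u) * x - c) ^ 2 + u / (1 + u)) ≤
        (1 + 2 * (x - c) ^ 2) * marginalDensity u x +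
          2 * ((x / (1 + u)) ^ 2 * marginalDensity u x) := by
    intro u hu
    have hm := marginalDensity_nonneg u x
    have h1 : u / (1 + u) ≤ 1 := by rw [div_le_one (by linarith)]; linarith
    have h2 : u / (1 + u) * x - c = (x - c) - x / (1 + u) := by
      field_simp
      ring
    have h3 : (u / (1 + u) * x - c) ^ 2 + u / (1 + u) ≤
        1 + 2 * (x - c) ^ 2 + 2 * (x / (1 + u)) ^ 2 := by
      rw [h2]
      nlinarith [sq_nonneg ((x - c) + x / (1 + u))]
    nlinarith [mul_le_mul_of_nonneg_left h3 hm]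
  rw [unnormSqLoss_coordPrior hτ]
  rcases le_or_gt (x ^ 2) T with hxT | hxT
  · rw [evidence_coordPrior hτ, ← lintegral_const_mul _ (by fun_prop)]
    refine lintegral_mono_ae (ae_localScaleLaw_pos.mono fun t ht => ?_)
    have hu : 0 < t * τ ^ 2 := by positivity
    rw [← ENNReal.ofReal_mul (by positivity)]
    refine ENNReal.ofReal_le_ofReal ((hsplit _ hu).trans ?_)
    have hm := marginalDensity_nonneg (t * τ ^ 2) x
    have h1 : (x / (1 + t * τ ^ 2)) ^ 2 ≤ T := by
      refine le_trans ?_ hxT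
      rw [div_pow]
      exact div_le_self (sq_nonneg x) (by nlinarith)
    have h2 : 0 ≤ 416 / c₁ := by positivity
    nlinarith [mul_le_mul_of_nonneg_right
      (show (x / (1 + t * τ ^ 2)) ^ 2 ≤ T + 416 / c₁ + 8 * Real.log (1 / τ) by linarith) hm]
  · have hx : 1 ≤ |x| := by
      rw [← one_le_sq_iff_one_le_abs]
      linarith
    have hev := le_evidence_of_large hK ha' hL hc₀ hLt hτ hτ1 hx ((le_max_right _ _).trans hxT.le)
    rw [← hc₁] at hev
    set A := 1 + 2 * (x - c) ^ 2 + 16 * Real.log (1 / τ) with hA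
    have hA0 : 0 ≤ A := by positivity
    have hpt : ∀ᵐ t ∂(localScaleLaw K a L),
        ENNReal.ofReal (marginalDensity (t * τ ^ 2) x *
          ((t * τ ^ 2 / (1 + t * τ ^ 2) * x - c) ^ 2 + t * τ ^ 2 / (1 + t * τ ^ 2))) ≤
        ENNReal.ofReal A * ENNReal.ofReal (marginalDensity (t * τ ^ 2) x) +
          ENNReal.ofReal (2 * 416 / c₁) * ENNReal.ofReal (c₁ * (τ ^ 2 / |x| ^ 3)) := by
      refine ae_localScaleLaw_pos.mono fun t ht => ?_
      have hu : 0 < t * τ ^ 2 := by positivity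
      have hm := marginalDensity_nonneg (t * τ ^ 2) x
      rw [← ENNReal.ofReal_mul hA0, ← ENNReal.ofReal_mul (by positivity),
        ← ENNReal.ofReal_add (by positivity) (by positivity)]
      refine ENNReal.ofReal_le_ofReal ((hsplit _ hu).trans ?_)
      have h1 := sq_shrinkage_mul_marginalDensity_le hτ hτ1 hu.le
        (abs_pos.1 (by linarith) : x ≠ 0)
      have h2 : 2 * 416 / c₁ * (c₁ * (τ ^ 2 / |x| ^ 3)) = 2 * (416 * (τ ^ 2 / |x| ^ 3)) := by
        field_simp
      rw [h2, hA]
      linarith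
    refine (lintegral_mono_ae hpt).trans ?_
    rw [lintegral_add_right _ measurable_const, lintegral_const_mul _ (by fun_prop),
      ← evidence_coordPrior hτ, lintegral_const, measure_univ, mul_one]
    calc ENNReal.ofReal A * evidence ν x +
          ENNReal.ofReal (2 * 416 / c₁) * ENNReal.ofReal (c₁ * (τ ^ 2 / |x| ^ 3))
        ≤ ENNReal.ofReal A * evidence ν x + ENNReal.ofReal (2 * 416 / c₁) * evidence ν x := by
          gcongr
      _ = ENNReal.ofReal (A + 2 * 416 / c₁) * evidence ν x := by
          rw [ENNReal.ofReal_add hA0 (by positivity), add_mul]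
      _ ≤ _ := by
          refine mul_le_mul' (ENNReal.ofReal_le_ofReal ?_) le_rfl
          have : 2 * 416 / c₁ = 2 * (416 / c₁) := by ring
          rw [hA, this]
          linarith

/-- The risk at any mean is at most of order `1 + log (1 / τ)`, uniformly in the mean. -/
lemma exists_coordRisk_le (hK : 0 < K) (ha' : a < 1) (hL : Measurable L)
    (hL_lower : ∃ c₀ t₀ : ℝ, 0 < c₀ ∧ 0 < t₀ ∧ ∀ t : ℝ, t₀ ≤ t → c₀ ≤ L t)
    [IsProbabilityMeasure (localScaleLaw K a L)] :
    ∃ C : ℝ, 0 ≤ C ∧ ∀ τ : ℝ, 0 < τ → τ ≤ 1 → ∀ c : ℝ,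
      coordRisk (coordPrior K a L τ) c ≤ ENNReal.ofReal (C * (1 + Real.log (1 / τ))) := by
  obtain ⟨C, hC, h⟩ := exists_unnormSqLoss_le hK ha' hL hL_lower
  refine ⟨19 + 2 * C, by positivity, fun τ hτ hτ1 c => ?_⟩
  have hl : 0 ≤ Real.log (1 / τ) := Real.log_nonneg (by rw [le_div_iff₀ hτ]; linarith)
  set D := 1 + 2 * (C + 8 * Real.log (1 / τ)) with hD
  have hD0 : 0 ≤ D := by positivity
  calc coordRisk (coordPrior K a L τ) c
      ≤ ∫⁻ x, (ENNReal.ofReal D + ENNReal.ofReal 2 * ENNReal.ofReal ((x - c) ^ 2))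
          ∂(gaussianReal c 1) := by
        refine lintegral_mono fun x => ENNReal.div_le_of_le_mul ((h τ hτ hτ1 c x).trans_eq ?_)
        rw [← ENNReal.ofReal_mul (by norm_num), ← ENNReal.ofReal_add hD0 (by positivity)]
        congr 2
        rw [hD]
        ring
    _ = ENNReal.ofReal (D + 2) := by
        rw [lintegral_add_left measurable_const, lintegral_const_mul _ (by fun_prop),
          lintegral_sq_sub_gaussianReal, lintegral_const, measure_univ, mul_one,
          ← ENNReal.ofReal_mul (by norm_num), ← ENNReal.ofReal_add hD0 (by positivity)]
        simp
    _ ≤ _ := by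
        refine ENNReal.ofReal_le_ofReal ?_
        rw [hD]
        nlinarith [mul_nonneg hC hl]

end Prior

/-! ### Risk at mean zero -/

lemma one_add_sq_mul_exp_le (x : ℝ) {b : ℝ} (hb : 1 ≤ b) :
    (1 + x ^ 2) * Real.exp (-(x ^ 2 / b)) ≤ b := by
  have h := Real.add_one_le_exp (x ^ 2 / b)
  rw [Real.exp_neg, ← div_eq_mul_inv, div_le_iff₀ (Real.exp_pos _)]
  have h2 : b * (x ^ 2 / b) = x ^ 2 := by field_simp
  nlinarith

/-- A function of `u` with derivative `(1 + u)⁻² (x² exp (-x² / (2 (1 + u))) + 1)`, an upper bound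
for the weight `(1 + u)⁻² (1 + x²) exp (-x² / (2 (1 + u)))` that large scales `u` carry in the
shrinkage integral at zero. -/
def tailPrimitive (x u : ℝ) : ℝ :=
  2 * Real.exp (-x ^ 2 / (2 * (1 + u))) - (1 + u)⁻¹

lemma hasDerivAt_tailPrimitive (x : ℝ) {τ t : ℝ} (ht : 0 ≤ t) :
    HasDerivAt (fun t => tailPrimitive x (t * τ ^ 2))
      (τ ^ 2 * ((1 + t * τ ^ 2) ^ 2)⁻¹ *
        (x ^ 2 * Real.exp (-x ^ 2 / (2 * (1 + t * τ ^ 2))) + 1)) t := by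
  have h0 : 1 + t * τ ^ 2 ≠ 0 := by positivity
  have h1 : HasDerivAt (fun t : ℝ => 1 + t * τ ^ 2) (τ ^ 2) t := by
    simpa using ((hasDerivAt_id t).mul_const (τ ^ 2)).const_add 1
  have h2 := h1.fun_inv h0
  have h3 : HasDerivAt (fun t : ℝ => -x ^ 2 / (2 * (1 + t * τ ^ 2)))
      (-x ^ 2 / 2 * (-(τ ^ 2) / (1 + t * τ ^ 2) ^ 2)) t := by
    refine (h2.const_mul (-x ^ 2 / 2)).congr_of_eventuallyEq (Eventually.of_forall fun s => ?_)
    simp only [div_eq_mul_inv, mul_inv]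
    ring
  refine ((h3.exp.const_mul 2).sub h2).congr_deriv ?_
  field_simp
  ring

lemma tendsto_tailPrimitive (x : ℝ) {τ : ℝ} (hτ : 0 < τ) :
    Tendsto (fun t => tailPrimitive x (t * τ ^ 2)) atTop (𝓝 2) := by
  have h1 : Tendsto (fun t : ℝ => 1 + t * τ ^ 2) atTop atTop :=
    tendsto_atTop_add_const_left _ _ (tendsto_id.atTop_mul_const (by positivity))
  have h2 : Tendsto (fun t : ℝ => -x ^ 2 / (2 * (1 + t * τ ^ 2))) atTop (𝓝 0) :=
    (h1.const_mul_atTop two_pos).const_div_atTop _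
  have h3 := (((Real.continuous_exp.tendsto 0).comp h2).const_mul 2).sub h1.inv_tendsto_atTop
  simpa [tailPrimitive] using h3

lemma lintegral_tail_le (x : ℝ) {τ t₁ : ℝ} (hτ : 0 < τ) (ht₁ : 0 < t₁) :
    ∫⁻ t in Set.Ioi t₁, ENNReal.ofReal (τ ^ 2 * ((1 + t * τ ^ 2) ^ 2)⁻¹ *
        (x ^ 2 * Real.exp (-x ^ 2 / (2 * (1 + t * τ ^ 2))) + 1)) ≤ ENNReal.ofReal 3 := by
  have hd : ∀ t ∈ Set.Ici t₁, HasDerivAt (fun t => tailPrimitive x (t * τ ^ 2)) _ t :=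
    fun t ht => hasDerivAt_tailPrimitive x (τ := τ) (ht₁.le.trans ht)
  have hnn : ∀ t ∈ Set.Ioi t₁, 0 ≤ τ ^ 2 * ((1 + t * τ ^ 2) ^ 2)⁻¹ *
        (x ^ 2 * Real.exp (-x ^ 2 / (2 * (1 + t * τ ^ 2))) + 1) := fun t _ => by positivity
  have hlim := tendsto_tailPrimitive x hτ
  rw [← ofReal_integral_eq_lintegral_ofReal (integrableOn_Ioi_deriv_of_nonneg' hd hnn hlim)
    ((ae_restrict_mem measurableSet_Ioi).mono hnn),
    integral_Ioi_of_hasDerivAt_of_nonneg' hd hnn hlim]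
  refine ENNReal.ofReal_le_ofReal ?_
  have h1 : (1 + t₁ * τ ^ 2)⁻¹ ≤ 1 := inv_le_one_of_one_le₀ (by nlinarith [sq_nonneg τ])
  have h2 := Real.exp_nonneg (-x ^ 2 / (2 * (1 + t₁ * τ ^ 2)))
  simp only [tailPrimitive]
  linarith

lemma lintegral_rpow_neg_le {a τ : ℝ} (ha : 1 / 2 ≤ a) (ha' : a < 1) (hτ : 0 < τ) (hτ1 : τ ≤ 1) :
    ∫⁻ t in Set.Ioc 0 (1 / τ ^ 2), ENNReal.ofReal (t ^ (-a)) ≤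
      ENNReal.ofReal ((1 - a)⁻¹ * (1 / τ)) := by
  have hb : 0 ≤ 1 / τ ^ 2 := by positivity
  have hint : IntegrableOn (fun t : ℝ => t ^ (-a)) (Set.Ioc 0 (1 / τ ^ 2)) :=
    (intervalIntegrable_iff_integrableOn_Ioc_of_le hb).1
      (intervalIntegral.intervalIntegrable_rpow' (by linarith))
  rw [← ofReal_integral_eq_lintegral_ofReal hint
    ((ae_restrict_mem measurableSet_Ioc).mono fun t ht => Real.rpow_nonneg ht.1.le _),
    ← intervalIntegral.integral_of_le hb, integral_rpow (Or.inl (by linarith))]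
  refine ENNReal.ofReal_le_ofReal ?_
  rw [Real.zero_rpow (by linarith), sub_zero, div_eq_inv_mul,
    show -a + 1 = 1 - a by ring]
  have h1a : 0 < 1 - a := by linarith
  gcongr
  calc (1 / τ ^ 2) ^ (1 - a) ≤ (1 / τ ^ 2) ^ (1 / 2 : ℝ) := by
        refine Real.rpow_le_rpow_of_exponent_le ?_ (by linarith)
        rw [le_div_iff₀ (by positivity)]
        nlinarith
    _ = 1 / τ := by
        rw [← Real.sqrt_eq_rpow, ← one_div_pow, Real.sqrt_sq (by positivity)]

lemma small_scale_le {u x : ℝ} (hu : 0 ≤ u) (hu1 : u ≤ 1) :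
    (1 + x ^ 2) * (u / (1 + u)) * marginalDensity u x ≤ 4 * u := by
  have h1 : u / (1 + u) ≤ u := div_le_self hu (by linarith)
  have h2 : marginalDensity u x ≤ Real.exp (-(x ^ 2 / 4)) := by
    have he : Real.exp (-x ^ 2 / (2 * (1 + u))) ≤ Real.exp (-(x ^ 2 / 4)) := by
      rw [Real.exp_le_exp, neg_div, neg_le_neg_iff]
      gcongr
      linarith
    have h3 := inv_le_one_of_one_le₀ (one_le_sqrt_two_pi_mul hu)
    have := mul_le_mul h3 he (Real.exp_nonneg _) zero_le_one
    rwa [one_mul] at this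
  have h4 := marginalDensity_nonneg u x
  calc (1 + x ^ 2) * (u / (1 + u)) * marginalDensity u x
      ≤ (1 + x ^ 2) * u * Real.exp (-(x ^ 2 / 4)) := by gcongr
    _ = ((1 + x ^ 2) * Real.exp (-(x ^ 2 / 4))) * u := by ring
    _ ≤ 4 * u := by
        gcongr
        exact one_add_sq_mul_exp_le x (by norm_num)

lemma large_scale_le {a τ t x : ℝ} (ha : 1 / 2 ≤ a) (hτ : 0 < τ) (hτ1 : τ ≤ 1)
    (ht : 1 / τ ^ 2 ≤ t) :
    t ^ (-a - 1) * ((1 + x ^ 2) * (t * τ ^ 2 / (1 + t * τ ^ 2)) * marginalDensity (t * τ ^ 2) x) ≤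
      4 * τ * (τ ^ 2 * ((1 + t * τ ^ 2) ^ 2)⁻¹ *
        (x ^ 2 * Real.exp (-x ^ 2 / (2 * (1 + t * τ ^ 2))) + 1)) := by
  have hτ2 : 0 < τ ^ 2 := by positivity
  have hu : 1 ≤ t * τ ^ 2 := by rwa [div_le_iff₀ hτ2] at ht
  have ht1 : 1 ≤ t := by nlinarith
  have ht0 : 0 < t := by linarith
  set u := t * τ ^ 2 with hudef
  have hz : u / (1 + u) ≤ 1 := by
    rw [div_le_one (by linarith)]
    linarith
  have he : Real.exp (-x ^ 2 / (2 * (1 + u))) ≤ 1 := by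
    rw [Real.exp_le_one_iff, neg_div, neg_nonpos]
    positivity
  set e := Real.exp (-x ^ 2 / (2 * (1 + u))) with hedef
  have he0 : 0 ≤ e := Real.exp_nonneg _
  have hxe : (1 + x ^ 2) * e ≤ x ^ 2 * e + 1 := by linarith
  -- Since `t ≥ (1 + u) / (2 τ²)`, the power `t ^ (-3/2)` supplies `τ³ (1 + u) ^ (-3/2)`, and the
  -- normalizing constant of the marginal density supplies the missing `(1 + u) ^ (-1/2)`.
  have hpow : t ^ (-a - 1) ≤ (t * √t)⁻¹ := by
    calc t ^ (-a - 1) ≤ t ^ (-(1 + 1 / 2) : ℝ) :=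
          Real.rpow_le_rpow_of_exponent_le ht1 (by linarith)
      _ = (t * √t)⁻¹ := by
          rw [Real.rpow_neg ht0.le, Real.rpow_add ht0, Real.rpow_one, ← Real.sqrt_eq_rpow]
  have htu : (1 + u) / (2 * τ ^ 2) ≤ t := by
    rw [div_le_iff₀ (by positivity)]
    nlinarith
  have hsq : (1 + u) / (2 * τ) ≤ √t * √(2 * Real.pi * (1 + u)) := by
    rw [← Real.sqrt_mul ht0.le]
    refine Real.le_sqrt_of_sq_le ?_
    calc ((1 + u) / (2 * τ)) ^ 2 = (1 + u) / (2 * τ ^ 2) * (1 / 2 * (1 + u)) := by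
          field_simp
      _ ≤ t * (2 * Real.pi * (1 + u)) := by
          gcongr
          linarith [Real.pi_gt_three]
  have hden : (t * √t)⁻¹ * (√(2 * Real.pi * (1 + u)))⁻¹ ≤ 4 * τ * (τ ^ 2 * ((1 + u) ^ 2)⁻¹) := by
    calc (t * √t)⁻¹ * (√(2 * Real.pi * (1 + u)))⁻¹
        = (t * (√t * √(2 * Real.pi * (1 + u))))⁻¹ := by rw [← mul_inv, mul_assoc]
      _ ≤ ((1 + u) / (2 * τ ^ 2) * ((1 + u) / (2 * τ)))⁻¹ := by gcongr
      _ = 4 * τ * (τ ^ 2 * ((1 + u) ^ 2)⁻¹) := by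
          field_simp
          ring
  calc t ^ (-a - 1) * ((1 + x ^ 2) * (u / (1 + u)) * marginalDensity u x)
      ≤ (t * √t)⁻¹ * ((1 + x ^ 2) * 1 * marginalDensity u x) := by
        have := marginalDensity_nonneg u x
        gcongr
    _ = ((t * √t)⁻¹ * (√(2 * Real.pi * (1 + u)))⁻¹) * ((1 + x ^ 2) * e) := by
        rw [marginalDensity]
        ring
    _ ≤ (4 * τ * (τ ^ 2 * ((1 + u) ^ 2)⁻¹)) * (x ^ 2 * e + 1) := by gcongr
    _ = _ := by ring

section Prior

variable {K a : ℝ} {L : ℝ → ℝ}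

/-- The unnormalized posterior loss at zero is of order `τ`, uniformly in the observation. Scales
`t ≤ 1 / τ²` contribute `∫ τ² t ^ (-a)`, which needs `a < 1`; for larger scales the factor
`t ^ (-a - 1)` with `a ≥ 1/2` leaves an exact derivative in `t`. -/
lemma exists_unnormSqLoss_zero_le (hK : 0 < K) (ha : 1 / 2 ≤ a) (ha' : a < 1) (hL : Measurable L)
    (hL_pos : ∀ t : ℝ, 0 < t → 0 < L t) (hL_upper : ∃ B : ℝ, ∀ t : ℝ, 0 < t → L t ≤ B) :
    ∃ C : ℝ, 0 ≤ C ∧ ∀ τ : ℝ, 0 < τ → τ ≤ 1 → ∀ x : ℝ,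
      unnormSqLoss (coordPrior K a L τ) 0 x ≤ ENNReal.ofReal (C * τ) := by
  obtain ⟨B, hB⟩ := hL_upper
  have hB0 : 0 < B := (hL_pos 1 one_pos).trans_le (hB 1 one_pos)
  have h1a : 0 < 1 - a := by linarith
  refine ⟨K * B * 4 * (1 - a)⁻¹ + K * B * 12, by positivity, fun τ hτ hτ1 x => ?_⟩
  have hτ2 : 0 < τ ^ 2 := by positivity
  rw [unnormSqLoss_coordPrior hτ, lintegral_localScaleLaw hL (by fun_prop),
    ← Set.Ioc_union_Ioi_eq_Ioi (show (0 : ℝ) ≤ 1 / τ ^ 2 by positivity)]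
  have hpt : ∀ t : ℝ, 0 < t →
      ENNReal.ofReal (K * t ^ (-a - 1) * L t) * ENNReal.ofReal (marginalDensity (t * τ ^ 2) x *
        ((t * τ ^ 2 / (1 + t * τ ^ 2) * x - 0) ^ 2 + t * τ ^ 2 / (1 + t * τ ^ 2))) ≤
      ENNReal.ofReal (K * B * (t ^ (-a - 1) *
        ((1 + x ^ 2) * (t * τ ^ 2 / (1 + t * τ ^ 2)) * marginalDensity (t * τ ^ 2) x))) := by
    intro t ht
    have hm := marginalDensity_nonneg (t * τ ^ 2) x
    have hLt := hL_pos t ht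
    rw [← ENNReal.ofReal_mul (by positivity)]
    refine ENNReal.ofReal_le_ofReal ?_
    have hz0 : 0 ≤ t * τ ^ 2 / (1 + t * τ ^ 2) := by positivity
    have hz1 : t * τ ^ 2 / (1 + t * τ ^ 2) ≤ 1 := by
      rw [div_le_one (by positivity)]
      linarith
    set z := t * τ ^ 2 / (1 + t * τ ^ 2)
    have hz : (z * x - 0) ^ 2 + z ≤ (1 + x ^ 2) * z := by
      nlinarith [mul_nonneg (mul_nonneg hz0 (sub_nonneg.2 hz1)) (sq_nonneg x)]
    calc K * t ^ (-a - 1) * L t * (marginalDensity (t * τ ^ 2) x * ((z * x - 0) ^ 2 + z))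
        ≤ K * t ^ (-a - 1) * B * (marginalDensity (t * τ ^ 2) x * ((1 + x ^ 2) * z)) := by
          gcongr
          exact hB t ht
      _ = _ := by ring
  refine (lintegral_union_le _ _ _).trans ?_
  rw [add_mul, ENNReal.ofReal_add (by positivity) (by positivity)]
  refine add_le_add ?_ ?_
  · calc _ ≤ ∫⁻ t in Set.Ioc 0 (1 / τ ^ 2),
          ENNReal.ofReal (K * B * 4 * τ ^ 2) * ENNReal.ofReal (t ^ (-a)) := by
          refine setLIntegral_mono' measurableSet_Ioc fun t ht => (hpt t ht.1).trans ?_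
          rw [← ENNReal.ofReal_mul (by positivity)]
          refine ENNReal.ofReal_le_ofReal ?_
          have ht0 := ht.1
          have hs := small_scale_le (x := x) (mul_nonneg ht0.le hτ2.le)
            ((le_div_iff₀ hτ2).1 ht.2)
          have hpow : t ^ (-a) = t ^ (-a - 1) * t := by
            rw [← Real.rpow_add_one ht0.ne']
            ring_nf
          calc _ ≤ K * B * (t ^ (-a - 1) * (4 * (t * τ ^ 2))) := by gcongr
            _ = _ := by
              rw [hpow]
              ring
      _ ≤ ENNReal.ofReal (K * B * 4 * τ ^ 2) * ENNReal.ofReal ((1 - a)⁻¹ * (1 / τ)) := by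
          rw [lintegral_const_mul' _ _ ENNReal.ofReal_ne_top]
          gcongr
          exact lintegral_rpow_neg_le ha ha' hτ hτ1
      _ = _ := by
          rw [← ENNReal.ofReal_mul (by positivity)]
          congr 1
          field_simp
  · calc _ ≤ ∫⁻ t in Set.Ioi (1 / τ ^ 2), ENNReal.ofReal (K * B * (4 * τ)) *
          ENNReal.ofReal (τ ^ 2 * ((1 + t * τ ^ 2) ^ 2)⁻¹ *
            (x ^ 2 * Real.exp (-x ^ 2 / (2 * (1 + t * τ ^ 2))) + 1)) := by
          refine setLIntegral_mono' measurableSet_Ioi fun t ht => ?_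
          have ht0 : 0 < t := lt_trans (by positivity) ht
          refine (hpt t ht0).trans ?_
          rw [← ENNReal.ofReal_mul (by positivity), mul_assoc (K * B)]
          refine ENNReal.ofReal_le_ofReal ?_
          exact mul_le_mul_of_nonneg_left (large_scale_le ha hτ hτ1 (le_of_lt ht))
            (by positivity)
      _ ≤ ENNReal.ofReal (K * B * (4 * τ)) * ENNReal.ofReal 3 := by
          rw [lintegral_const_mul' _ _ ENNReal.ofReal_ne_top]
          gcongr
          exact lintegral_tail_le x hτ (by positivity)
      _ = _ := by
          rw [← ENNReal.ofReal_mul (by positivity)]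
          congr 1
          ring

/-- Since `τ ≤ 1`, the scale `t τ²` is at most `t`, which bounds the marginal density below by a
fixed multiple of `exp (-x² / 2)`. -/
lemma exists_le_evidence [IsProbabilityMeasure (localScaleLaw K a L)] :
    ∃ c : ℝ, 0 < c ∧ ∀ τ : ℝ, 0 < τ → τ ≤ 1 → ∀ x : ℝ,
      ENNReal.ofReal (c * Real.exp (-(x ^ 2 / 2))) ≤ evidence (coordPrior K a L τ) x := by
  set I := ∫⁻ t, ENNReal.ofReal (√(2 * Real.pi * (1 + t)))⁻¹ ∂(localScaleLaw K a L) with hI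
  have hIt : I ≠ ⊤ := by
    refine ((lintegral_mono_ae (g := fun _ => 1) (ae_localScaleLaw_pos.mono fun t ht => ?_)).trans_lt
      (by simp)).ne
    rw [ENNReal.ofReal_le_one]
    exact inv_le_one_of_one_le₀ (one_le_sqrt_two_pi_mul ht.le)
  have hI0 : I ≠ 0 := by
    intro h
    rw [hI, lintegral_eq_zero_iff (by fun_prop)] at h
    obtain ⟨t, h1, h2⟩ := (h.and (ae_localScaleLaw_pos (K := K) (a := a) (L := L))).exists
    have h3 := one_le_sqrt_two_pi_mul h2.le
    have h4 : 0 < (√(2 * Real.pi * (1 + t)))⁻¹ := by positivity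
    exact (ENNReal.ofReal_pos.2 h4).ne' h1
  refine ⟨I.toReal, ENNReal.toReal_pos hI0 hIt, fun τ hτ hτ1 x => ?_⟩
  rw [evidence_coordPrior hτ, ENNReal.ofReal_mul ENNReal.toReal_nonneg, ENNReal.ofReal_toReal hIt,
    hI, ← lintegral_mul_const _ (by fun_prop)]
  refine lintegral_mono_ae (ae_localScaleLaw_pos.mono fun t ht => ?_)
  rw [← ENNReal.ofReal_mul (by positivity)]
  refine ENNReal.ofReal_le_ofReal ?_
  have hu : t * τ ^ 2 ≤ t := by
    have : τ ^ 2 ≤ 1 := by nlinarith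
    nlinarith
  have hu0 : 0 < t * τ ^ 2 := by positivity
  have hpi := Real.pi_pos
  unfold marginalDensity
  gcongr
  rw [neg_div, neg_le_neg_iff]
  gcongr
  linarith

lemma exists_posterior_zero_le (hK : 0 < K) (ha : 1 / 2 ≤ a) (ha' : a < 1) (hL : Measurable L)
    (hL_pos : ∀ t : ℝ, 0 < t → 0 < L t) (hL_upper : ∃ B : ℝ, ∀ t : ℝ, 0 < t → L t ≤ B)
    [IsProbabilityMeasure (localScaleLaw K a L)] :
    ∃ C : ℝ, 0 ≤ C ∧ ∀ τ : ℝ, 0 < τ → τ ≤ 1 → ∀ x : ℝ,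
      unnormSqLoss (coordPrior K a L τ) 0 x / evidence (coordPrior K a L τ) x ≤
        ENNReal.ofReal (C * τ * Real.exp (x ^ 2 / 2)) := by
  obtain ⟨C, hC, h1⟩ := exists_unnormSqLoss_zero_le hK ha ha' hL hL_pos hL_upper
  obtain ⟨c, hc, h2⟩ := exists_le_evidence (K := K) (a := a) (L := L)
  refine ⟨C / c, by positivity, fun τ hτ hτ1 x => ENNReal.div_le_of_le_mul ?_⟩
  calc _ ≤ ENNReal.ofReal (C * τ) := h1 τ hτ hτ1 x
    _ = ENNReal.ofReal (C / c * τ * Real.exp (x ^ 2 / 2)) *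
          ENNReal.ofReal (c * Real.exp (-(x ^ 2 / 2))) := by
        rw [← ENNReal.ofReal_mul (by positivity)]
        congr 1
        rw [Real.exp_neg]
        field_simp
    _ ≤ _ := by
        gcongr
        exact h2 τ hτ hτ1 x

lemma posterior_zero_le_one_add_sq [IsProbabilityMeasure (localScaleLaw K a L)] {τ : ℝ}
    (hτ : 0 < τ) (x : ℝ) :
    unnormSqLoss (coordPrior K a L τ) 0 x / evidence (coordPrior K a L τ) x ≤
      ENNReal.ofReal (1 + x ^ 2) := by
  refine ENNReal.div_le_of_le_mul ?_
  rw [unnormSqLoss_coordPrior hτ, evidence_coordPrior hτ, ← lintegral_const_mul _ (by fun_prop)]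
  refine lintegral_mono_ae (ae_localScaleLaw_pos.mono fun t ht => ?_)
  rw [← ENNReal.ofReal_mul (by positivity), mul_comm (1 + x ^ 2)]
  refine ENNReal.ofReal_le_ofReal
    (mul_le_mul_of_nonneg_left ?_ (marginalDensity_nonneg _ _))
  have hz0 : 0 ≤ t * τ ^ 2 / (1 + t * τ ^ 2) := by positivity
  have hz1 : t * τ ^ 2 / (1 + t * τ ^ 2) ≤ 1 := by
    rw [div_le_one (by positivity)]
    linarith
  set z := t * τ ^ 2 / (1 + t * τ ^ 2)
  have hz2 : z ^ 2 ≤ 1 := by nlinarith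
  nlinarith [sq_nonneg x]

/-- The risk at mean zero is of order `τ (1 + log (1 / τ))`: the posterior loss is at most
`C τ exp (x² / 2)`, which is used for `|x| ≤ 2 (1 + log (1 / τ))`, and at most `1 + x²`, which is
used in the normal tail beyond. -/
lemma exists_coordRisk_zero_le (hK : 0 < K) (ha : 1 / 2 ≤ a) (ha' : a < 1) (hL : Measurable L)
    (hL_pos : ∀ t : ℝ, 0 < t → 0 < L t) (hL_upper : ∃ B : ℝ, ∀ t : ℝ, 0 < t → L t ≤ B)
    [IsProbabilityMeasure (localScaleLaw K a L)] :
    ∃ C : ℝ, 0 ≤ C ∧ ∀ τ : ℝ, 0 < τ → τ ≤ 1 →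
      coordRisk (coordPrior K a L τ) 0 ≤ ENNReal.ofReal (C * (τ * (1 + Real.log (1 / τ)))) := by
  obtain ⟨C, hC, h⟩ := exists_posterior_zero_le hK ha ha' hL hL_pos hL_upper
  have hgauss : Integrable fun x : ℝ => Real.exp (-(1 / 8) * x ^ 2) :=
    integrable_exp_neg_mul_sq (by norm_num)
  set J := ∫ x : ℝ, Real.exp (-(1 / 8) * x ^ 2) with hJ
  have hJ0 : 0 ≤ J := integral_nonneg fun _ => Real.exp_nonneg _
  refine ⟨4 * C + 8 * J, by positivity, fun τ hτ hτ1 => ?_⟩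
  have := isProbabilityMeasure_coordPrior (K := K) (a := a) (L := L) τ
  have hl : 0 ≤ Real.log (1 / τ) := Real.log_nonneg (by rw [le_div_iff₀ hτ]; linarith)
  set l := Real.log (1 / τ) with hldef
  set ζ := 2 * (1 + l) with hζ
  have hζ0 : 0 ≤ ζ := by positivity
  set ν := coordPrior K a L τ
  have hmeas : Measurable fun x => unnormSqLoss ν 0 x / evidence ν x :=
    (measurable_unnormSqLoss ν _).div (measurable_evidence ν)
  have hpdf : ∀ x : ℝ, gaussianPDF 0 1 x ≤ ENNReal.ofReal (Real.exp (-(x ^ 2 / 2))) := by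
    intro x
    refine ENNReal.ofReal_le_ofReal ?_
    have h1 := inv_le_one_of_one_le₀ (one_le_sqrt_two_pi_mul le_rfl)
    simp only [gaussianPDFReal, NNReal.coe_one, mul_one, sub_zero, add_zero] at h1 ⊢
    rw [neg_div]
    exact mul_le_of_le_one_left (Real.exp_nonneg _) h1
  have hpt : ∀ x : ℝ, gaussianPDF 0 1 x * (unnormSqLoss ν 0 x / evidence ν x) ≤
      (Set.Icc (-ζ) ζ).indicator (fun _ => ENNReal.ofReal (C * τ)) x +
        ENNReal.ofReal (8 * τ) * ENNReal.ofReal (Real.exp (-(1 / 8) * x ^ 2)) := by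
    intro x
    by_cases hx : x ∈ Set.Icc (-ζ) ζ
    · rw [Set.indicator_of_mem hx]
      refine le_add_right ((mul_le_mul' (hpdf x) (h τ hτ hτ1 x)).trans_eq ?_)
      rw [← ENNReal.ofReal_mul (Real.exp_nonneg _)]
      congr 1
      rw [Real.exp_neg]
      field_simp
    · rw [Set.indicator_of_notMem hx, zero_add, ← ENNReal.ofReal_mul (by positivity)]
      refine (mul_le_mul' (hpdf x) (posterior_zero_le_one_add_sq hτ x)).trans ?_
      rw [← ENNReal.ofReal_mul (Real.exp_nonneg _)]
      refine ENNReal.ofReal_le_ofReal ?_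
      have hxζ : ζ ^ 2 ≤ x ^ 2 := by
        rw [Set.mem_Icc, ← abs_le, not_le] at hx
        rw [← sq_abs x]
        gcongr
      have hτe : Real.exp (-(x ^ 2 / 4)) ≤ τ := by
        have e1 : τ = Real.exp (-l) := by
          rw [hldef, one_div, Real.log_inv, neg_neg, Real.exp_log hτ]
        rw [e1, Real.exp_le_exp]
        rw [hζ] at hxζ
        nlinarith
      have hsplit : Real.exp (-(x ^ 2 / 2)) = Real.exp (-(x ^ 2 / 8)) *
          Real.exp (-(1 / 8) * x ^ 2) * Real.exp (-(x ^ 2 / 4)) := by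
        rw [← Real.exp_add, ← Real.exp_add]
        ring_nf
      calc Real.exp (-(x ^ 2 / 2)) * (1 + x ^ 2)
          = ((1 + x ^ 2) * Real.exp (-(x ^ 2 / 8))) * Real.exp (-(1 / 8) * x ^ 2) *
              Real.exp (-(x ^ 2 / 4)) := by
            rw [hsplit]
            ring
        _ ≤ 8 * Real.exp (-(1 / 8) * x ^ 2) * τ := by
            gcongr
            exact one_add_sq_mul_exp_le x (by norm_num)
        _ = _ := by ring
  calc coordRisk ν 0
      = ∫⁻ x, gaussianPDF 0 1 x * (unnormSqLoss ν 0 x / evidence ν x) := by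
        rw [coordRisk, gaussianReal_of_var_ne_zero _ one_ne_zero,
          lintegral_withDensity_eq_lintegral_mul _ (measurable_gaussianPDF _ _) hmeas]
        rfl
    _ ≤ _ := lintegral_mono hpt
    _ = ENNReal.ofReal (C * τ) * ENNReal.ofReal (ζ - -ζ) + ENNReal.ofReal (8 * τ) *
          ENNReal.ofReal J := by
        rw [lintegral_add_left (measurable_const.indicator measurableSet_Icc),
          lintegral_indicator_const measurableSet_Icc, Real.volume_Icc,
          lintegral_const_mul' _ _ ENNReal.ofReal_ne_top,
          ← ofReal_integral_eq_lintegral_ofReal hgauss (ae_of_all _ fun _ => Real.exp_nonneg _)]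
    _ ≤ _ := by
        rw [← ENNReal.ofReal_mul (by positivity), ← ENNReal.ofReal_mul (by positivity),
          ← ENNReal.ofReal_add (mul_nonneg (by positivity) (by linarith)) (by positivity)]
        refine ENNReal.ofReal_le_ofReal ?_
        rw [hζ]
        nlinarith [mul_nonneg (mul_nonneg hτ.le hJ0) hl]

end Prior

/-! ### Sparse mean vectors -/

/-- If the risk is at most `r₀` at mean zero and at most `r₁` at every mean, then the coordinate
risks of a vector with at most `p` nonzero coordinates add up to at most `n r₀ + p r₁`. -/
lemma sum_coordRisk_le {n p : ℕ} {ν : Measure ℝ} {r₀ r₁ : ENNReal} (h₀ : coordRisk ν 0 ≤ r₀)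
    (h₁ : ∀ c, coordRisk ν c ≤ r₁) {θ₀ : Fin n → ℝ} (hθ : θ₀ ∈ nearlyBlack n p) :
    ∑ i, coordRisk ν (θ₀ i) ≤ n * r₀ + p * r₁ := by
  classical
  have hcard : ({j : Fin n | θ₀ j ≠ 0} : Finset (Fin n)).card ≤ p := by
    have h : ({j : Fin n | θ₀ j ≠ 0} : Set (Fin n)).ncard ≤ p := hθ
    rwa [Set.ncard_eq_toFinset_card', Set.toFinset_ofPred] at h
  calc ∑ i, coordRisk ν (θ₀ i) ≤ ∑ i, (r₀ + if θ₀ i ≠ 0 then r₁ else 0) := by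
        refine Finset.sum_le_sum fun i _ => ?_
        by_cases hi : θ₀ i = 0
        · simpa [hi] using h₀
        · simpa [hi] using le_add_left (h₁ (θ₀ i))
    _ = n * r₀ + ({j : Fin n | θ₀ j ≠ 0} : Finset (Fin n)).card * r₁ := by
        rw [Finset.sum_add_distrib, ← Finset.sum_filter]
        simp
    _ ≤ n * r₀ + p * r₁ := by gcongr

end GlobalLocal

end

theorem theorem3p3
    (K a α : ℝ) (L : ℝ → ℝ)
    (hK : 0 < K) (ha : 1 / 2 ≤ a) (ha' : a < 1) (hα : 1 ≤ α)
    (hL_meas : Measurable L)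
    (hL_pos : ∀ t : ℝ, 0 < t → 0 < L t)
    (hL_lower : ∃ c₀ t₀ : ℝ, 0 < c₀ ∧ 0 < t₀ ∧ ∀ t : ℝ, t₀ ≤ t → c₀ ≤ L t)
    (hL_upper : ∃ B : ℝ, ∀ t : ℝ, 0 < t → L t ≤ B)
    (hπ : IsProbabilityMeasure (GlobalLocal.localScaleLaw K a L))
    (p : ℕ → ℕ) (hp : Tendsto p atTop atTop)
    (hpn : Tendsto (fun n : ℕ => (p n : ℝ) / (n : ℝ)) atTop (𝓝 0))
    (M : ℕ → ℝ) (hM : Tendsto M atTop atTop) :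
    Tendsto
      (fun n : ℕ =>
        ⨆ θ₀ ∈ GlobalLocal.nearlyBlack n (p n),
          ∫⁻ x,
            GlobalLocal.posteriorLaw
              (GlobalLocal.prior K a L (((p n : ℝ) / (n : ℝ)) ^ α) n) x
              {θ | M n * (p n : ℝ) * Real.log ((n : ℝ) / (p n : ℝ)) <
                GlobalLocal.sqDist θ θ₀}
            ∂(GlobalLocal.modelLaw θ₀))
      atTop (𝓝 0) := by
  obtain ⟨C₀, hC₀, h₀⟩ :=
    GlobalLocal.exists_coordRisk_zero_le hK ha ha' hL_meas hL_pos hL_upper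
  obtain ⟨C₁, hC₁, h₁⟩ := GlobalLocal.exists_coordRisk_le hK ha' hL_meas hL_lower
  set D := (C₀ + C₁) * (2 * α) with hD
  have hD0 : 0 ≤ D := by positivity
  have hlim : Tendsto (fun n => ENNReal.ofReal (D / M n)) atTop (𝓝 0) := by
    simpa using ENNReal.tendsto_ofReal (hM.const_div_atTop D)
  refine tendsto_of_tendsto_of_tendsto_of_le_of_le' tendsto_const_nhds hlim
    (Eventually.of_forall fun _ => zero_le) ?_
  filter_upwards [hp.eventually_ge_atTop 1, hpn.eventually_le_const (Real.exp_pos (-1)),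
    hM.eventually_ge_atTop 1, eventually_ge_atTop 1] with n hpn1 hr hMn hn
  have hP : (1 : ℝ) ≤ p n := by exact_mod_cast hpn1
  have hN : (1 : ℝ) ≤ n := by exact_mod_cast hn
  set r : ℝ := (p n : ℝ) / n with hrdef
  have hr0 : 0 < r := by positivity
  have hr1 : r ≤ 1 := hr.trans (Real.exp_le_one_iff.2 (by norm_num))
  have hnr : (n : ℝ) * r = p n := by rw [hrdef]; field_simp
  have hlogr : Real.log ((n : ℝ) / p n) = -Real.log r := by
    rw [hrdef, ← Real.log_inv, inv_div]
  rw [hlogr]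
  set ℓ := -Real.log r with hℓdef
  have hℓ : 1 ≤ ℓ := by
    have := Real.log_le_log hr0 hr
    rw [Real.log_exp] at this
    linarith
  have hτ0 : 0 < r ^ α := Real.rpow_pos_of_pos hr0 α
  have hτr : r ^ α ≤ r := by
    simpa using Real.rpow_le_rpow_of_exponent_ge hr0 hr1 hα
  have hlogτ : 1 + Real.log (1 / r ^ α) ≤ 2 * α * ℓ := by
    rw [one_div, Real.log_inv, Real.log_rpow hr0]
    nlinarith
  have hlogτ0 : 0 ≤ Real.log (1 / r ^ α) :=
    Real.log_nonneg (by rw [le_div_iff₀ hτ0]; linarith)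
  set ν := GlobalLocal.coordPrior K a L (r ^ α)
  have : IsProbabilityMeasure ν := GlobalLocal.isProbabilityMeasure_coordPrior _
  have hR : 0 < M n * p n * ℓ := by positivity
  have hzero : GlobalLocal.coordRisk ν 0 ≤ ENNReal.ofReal (C₀ * (r * (2 * α * ℓ))) := by
    refine (h₀ _ hτ0 (hτr.trans hr1)).trans (ENNReal.ofReal_le_ofReal ?_)
    gcongr
  have hany : ∀ c, GlobalLocal.coordRisk ν c ≤ ENNReal.ofReal (C₁ * (2 * α * ℓ)) := fun c => by
    refine (h₁ _ hτ0 (hτr.trans hr1) c).trans (ENNReal.ofReal_le_ofReal ?_)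
    gcongr
  refine iSup₂_le fun θ₀ hθ₀ => (GlobalLocal.lintegral_posteriorLaw_le ν θ₀ hR).trans ?_
  refine (ENNReal.div_le_div_right (GlobalLocal.sum_coordRisk_le hzero hany hθ₀) _).trans_eq ?_
  rw [← ENNReal.ofReal_natCast, ← ENNReal.ofReal_natCast (p n),
    ← ENNReal.ofReal_mul (by positivity), ← ENNReal.ofReal_mul (by positivity),
    ← ENNReal.ofReal_add (by positivity) (by positivity), ← ENNReal.ofReal_div_of_pos hR]
  congr 1
  have hsum : (n : ℝ) * (C₀ * (r * (2 * α * ℓ))) + p n * (C₁ * (2 * α * ℓ)) =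
      D * (p n * ℓ) := by
    rw [hD, ← hnr]
    ring
  rw [hsum]
  field_simp
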